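/- Consider the two-player mining game with immediate release and infinite depth. A state is a pair $(\ell_1,\ell_2)\in\mathbb{N}^2$ ($\mathbb N=\{0,1,2,\dots\}$), the lengths of the branches of the two players. In each turn player $i$ wins the mining race with probability $p_i$, where $p_1,p_2>0$ and $p_1+p_2=1$. Player 2 (honest, Frontier strategy) capitulates at $(\ell_1,\ell_2)$ upon losing the race if and only if $\ell_1\ge \ell_2$. Player 1 has constant gap tolerance $g\ge 1$ and $s=0$: upon losing the race he continues at $(\ell,\ell+m)$ for $0\le m<g$ and capitulates at $(\ell,\ell+g)$, for every $\ell\in\mathbb{N}$. If player 1 wins the race at $(\ell_1,\ell_2)$, the next state is $(0,0)$ if player 2 capitulates and $(\ell_1+1,\ell_2)$ otherwise; if player 2 wins, the next state is $(0,0)$ if player 1 capitulates and $(\ell_1,\ell_2+1)$ otherwise. Let $\mathcal M$ be the set of states reachable from $(0,0)$ and $P$ the resulting transition matrix on $\mathcal M$. Let $\hat r_1(\ell_1,\ell_2)=p_1(\ell_1+1)$ at the states of $\mathcal M$ where player 2 capitulates upon losing, and $\hat r_1=0$ elsewhere; let $\hat r_2(\ell_1,\ell_2)=p_2(\ell_2+1)$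 at the states of $\mathcal M$ where player 1 capitulates upon losing, and $\hat r_2=0$ elsewhere. Let $L(\ell_1,\ell_2)$ be the number of lattice paths from $(0,0)$ to $(\ell_1,\ell_2)$ all of whose steps are transitions of the chain in which nobody capitulates. Then $\mathcal M=\{(\ell,\ell+m):\ell\in\mathbb{N},\ 0\le m\le g\}$, the chain $(\mathcal M,P)$ has exactly one stationary distribution $\pi$, and $$\pi(\ell,\ell+m)=\pi(0,0)\,L(\ell,\ell+m)\,p_1^{\ell}p_2^{\ell+m}\qquad(\ell\ge 0,\ 0\le m\le g).$$ Moreover, the series $\rho_i=\langle\pi,\hat r_i\rangle=\sum_{x\in\mathcal M}\pi(x)\hat r_i(x)$ converge, with $$\rho_1=\frac{p_1}{\Gamma}\sum_{k=1}^{g+1}\frac{\sin^2\left(\frac{\pi k}{g+2}\right)}{\left(1-4p_1p_2\cos^2\left(\frac{\pi k}{g+2}\right)\right)^2},$$ $$\rho_2=\frac{p_2^{g+1}}{\Gamma}\sum_{k=1}^{g+1}(-1)^{k-1}\frac{\sin^2\left(\frac{\pi k}{g+2}\right)\left(2\cos\left(\frac{\pi k}{g+2}\right)\right)^g}{\left(1-4p_1p_2\cos^2\left(\frac{\pi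 k}{g+2}\right)\right)^2}\left(g\left(1-4p_1p_2\cos^2\left(\frac{\pi k}{g+2}\right)\right)+1\right),$$ where $$\Gamma=\sum_{k=1}^{g+1}\sin\left(\frac{\pi k}{g+2}\right)\sum_{m=0}^{g}\sin\left(\frac{\pi k(m+1)}{g+2}\right)\frac{2^m\cos^m\left(\frac{\pi k}{g+2}\right)p_2^m}{1-4\cos^2\left(\frac{\pi k}{g+2}\right)p_1p_2}>0 .$$ (In the last three formulas, $\pi=3.14159\ldots$ denotes the number; elsewhere $\pi$ is the stationary distribution.) -/

import Mathlib

namespace MiningGame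

/-- A capitulation policy in the two-player immediate-release mining game with depth `d = ∞`.
`C ℓ₁ ℓ₂ = true` means: if a turn starts at state `(ℓ₁, ℓ₂)` and the player loses the mining
race of that turn, the player capitulates; `C ℓ₁ ℓ₂ = false` means that the player goes on mining
his or her own branch.  `s` is the number of the opponent's last blocks that are left
unvalidated by a capitulation. -/
structure CapPolicy where
  C : ℕ → ℕ → Bool
  s : ℕ

/-- The Frontier (honest) policy of player 2: capitulate, after a lost race, exactly at the states
with `ℓ₁ ≥ ℓ₂`, and accept all the blocks of player 1. -/
def frontier : CapPolicy where
  C := fun ℓ₁ ℓ₂ => decide (ℓ₂ ≤ ℓ₁)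
  s := 0

/-- Player 1 has constant gap tolerance `g`: for every length `ℓ` of the own branch, `g` is the
smallest lead `k` of player 2 at which player 1 is ready to capitulate. So player 1 continues
after losing the race at `(ℓ, ℓ + k)`, `k < g`, and capitulates after losing it at `(ℓ, ℓ + g)`. -/
def CapPolicy.HasConstantGapTolerance (A : CapPolicy) (g : ℕ) : Prop :=
  ∀ ℓ : ℕ, IsLeast {k : ℕ | A.C ℓ (ℓ + k) = true} g

/-- The next state if player 1 wins the race, when player 2 uses the policy `B`. -/
def next₁ (B : CapPolicy) (m : ℕ × ℕ) : ℕ × ℕ :=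
  if B.C m.1 m.2 = true then (B.s, 0) else (m.1 + 1, m.2)

/-- The next state if player 2 wins the race, when player 1 uses the policy `A`. -/
def next₂ (A : CapPolicy) (m : ℕ × ℕ) : ℕ × ℕ :=
  if A.C m.1 m.2 = true then (0, A.s) else (m.1, m.2 + 1)

/-- The state space `ℳ`: everything reachable from `(0, s₁)` or from `(s₂, 0)`. -/
def states (A B : CapPolicy) : Set (ℕ × ℕ) :=
  {m | ∃ m₀ : ℕ × ℕ, (m₀ = (0, A.s) ∨ m₀ = (B.s, 0)) ∧
    Relation.ReflTransGen (fun x y => y = next₁ B x ∨ y = next₂ A x) m₀ m}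

/-- The transition matrix `P`: player `i` wins the race with probability `pᵢ`. -/
noncomputable def transition (A B : CapPolicy) (p₁ p₂ : ℝ) (m m' : states A B) : ℝ :=
  (if next₁ B m.1 = m'.1 then p₁ else 0) + (if next₂ A m.1 = m'.1 then p₂ else 0)

/-- `π` is a stationary distribution of the chain `(ℳ, P)`. -/
structure IsStationary (A B : CapPolicy) (p₁ p₂ : ℝ) (π : states A B → ℝ) : Prop where
  nonneg : ∀ m, 0 ≤ π m
  total : HasSum π 1
  balance : ∀ m', HasSum (fun m => π m * transition A B p₁ p₂ m m') (π m')

/-- The expected reward vector `r̂₁` of player 1: it is supported on the states at which player 2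
capitulates when player 1 wins the race. -/
noncomputable def rHat₁ (A B : CapPolicy) (p₁ : ℝ) (m : states A B) : ℝ :=
  if B.C m.1.1 m.1.2 = true then p₁ * ((m.1.1 : ℝ) + 1 - (B.s : ℝ)) else 0

/-- The expected reward vector `r̂₂` of player 2: it is supported on the states at which player 1
capitulates when player 2 wins the race. -/
noncomputable def rHat₂ (A B : CapPolicy) (p₂ : ℝ) (m : states A B) : ℝ :=
  if A.C m.1.1 m.1.2 = true then p₂ * ((m.1.2 : ℝ) + 1 - (A.s : ℝ)) else 0

/-- An interior transition: the winner of the race extends the own branch and nobody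
capitulates. -/
def InteriorStep (A B : CapPolicy) (x y : ℕ × ℕ) : Prop :=
  (B.C x.1 x.2 = false ∧ y = (x.1 + 1, x.2)) ∨ (A.C x.1 x.2 = false ∧ y = (x.1, x.2 + 1))

/-- `L(ℓ₁, ℓ₂)`, the number of interior lattice paths from `(0, 0)` to `(ℓ₁, ℓ₂)`; a path is the
list of the states that it visits. -/
noncomputable def pathCount (A B : CapPolicy) (ℓ₁ ℓ₂ : ℕ) : ℕ :=
  Set.ncard {w : List (ℕ × ℕ) |
    w.head? = some (0, 0) ∧ w.getLast? = some (ℓ₁, ℓ₂) ∧ w.IsChain (InteriorStep A B)}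

/-- The constant `Γ`. -/
noncomputable def Gam (g : ℕ) (p₁ p₂ : ℝ) : ℝ :=
  ∑ k ∈ Finset.Icc 1 (g + 1), Real.sin (Real.pi * k / (g + 2)) *
    ∑ m ∈ Finset.range (g + 1), Real.sin (Real.pi * k * (m + 1) / (g + 2)) *
      (2 ^ m * Real.cos (Real.pi * k / (g + 2)) ^ m * p₂ ^ m /
        (1 - 4 * Real.cos (Real.pi * k / (g + 2)) ^ 2 * p₁ * p₂))

end MiningGame

/-! ### Walks in a strip and their spectral decomposition. -/

namespace MiningGame

open Finset

/-! Write a state as `(l, l + k)` with gap `k`. Without capitulation, a win of player 2 raises the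
gap by one and a win of player 1 lowers it by one, so an interior path to `(l, l + k)` is a `±1`
walk of `2 * l + k` steps in the strip `{0, …, g}` (`pathCount_frontier`).

Away from `(0, 0)` all inflow comes from states with `2 * l + k` smaller by one. The balance
equations there are thus the walk recursion with weights `p₁`, `p₂`, and force `π` to be `π(0,0)`
times `weight` (`IsStationary.zeroExtend_eq`). The equation at `(0, 0)` is then flow conservation
(`columnWeight_return`).

The adjacency matrix of the strip has eigenvectors `sin (π j (k + 1) / (g + 2))` and eigenvalues `2
cos (π j / (g + 2))` (`stripWalks_eq_sum`). For fixed gap, every mode of `weight` is therefore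
geometric in `l`. Summing over all states gives `2 / (g + 2) * Γ`, which fixes `π(0,0)`. The rewards
live on the columns of gap `0` and gap `g`, where they are arithmetic-geometric series. -/

/-- The number of walks with `n` steps `±1` from `0` to `k` that stay in `{0, …, g}`. -/
def stripWalks (g : ℕ) : ℕ → ℕ → ℕ
  | 0, k => if k = 0 then 1 else 0
  | n + 1, 0 => stripWalks g n 1
  | n + 1, k + 1 => if k + 1 ≤ g then stripWalks g n k + stripWalks g n (k + 2) else 0

lemma stripWalks_succ_succ {g k : ℕ} (n : ℕ) (hk : k + 1 ≤ g) :
    stripWalks g (n + 1) (k + 1) = stripWalks g n k + stripWalks g n (k + 2) := if_pos hk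

lemma stripWalks_of_gap_lt {g : ℕ} (n : ℕ) {k : ℕ} (hk : g < k) : stripWalks g n k = 0 := by
  obtain ⟨k, rfl⟩ : ∃ j, k = j + 1 := ⟨k - 1, by omega⟩
  cases n with
  | zero => simp [stripWalks]
  | succ n => simp [stripWalks, show ¬ k + 1 ≤ g by omega]

lemma stripWalks_of_lt (g : ℕ) {n k : ℕ} (h : n < k) : stripWalks g n k = 0 := by
  induction n generalizing k with
  | zero => simp [stripWalks, show k ≠ 0 by omega]
  | succ n ih =>
    obtain ⟨k, rfl⟩ : ∃ j, k = j + 1 := ⟨k - 1, by omega⟩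
    simp [stripWalks, ih (show n < k by omega), ih (show n < k + 2 by omega)]

/-- The Dirichlet kernel, kept free of division. -/
lemma sum_cos_mul (x : ℝ) (n : ℕ) :
    2 * Real.sin (x / 2) * ∑ j ∈ Icc 1 n, Real.cos (j * x)
      = Real.sin ((n + 1 / 2) * x) - Real.sin (x / 2) := by
  induction n with
  | zero => simp [div_eq_inv_mul]
  | succ n ih =>
    rw [Finset.sum_Icc_succ_top (by omega), mul_add, ih]
    have h1 : ((n + 1 : ℕ) + 1 / 2 : ℝ) * x = ((n + 1 : ℕ) : ℝ) * x + x / 2 := by ring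
    have h2 : ((n : ℝ) + 1 / 2) * x = ((n + 1 : ℕ) : ℝ) * x - x / 2 := by push_cast; ring
    rw [h1, h2, Real.sin_add, Real.sin_sub]
    ring

/-- The sum of `cos (π r j / N)` over `0 < j < N`, for `0 < r < 2 N`. -/
lemma sum_cos_pi_mul_div {N r : ℕ} (hr : 0 < r) (hrN : r < 2 * N) :
    ∑ j ∈ Icc 1 (N - 1), Real.cos (j * (Real.pi * r / N)) = (-1 - (-1) ^ r) / 2 := by
  have hN : (0 : ℝ) < N := by exact_mod_cast (by omega : 0 < N)
  have hr' : (0 : ℝ) < r := by exact_mod_cast hr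
  have hrN' : (r : ℝ) < 2 * N := by exact_mod_cast hrN
  set x : ℝ := Real.pi * r / N with hx
  have hs : 0 < Real.sin (x / 2) := by
    apply Real.sin_pos_of_pos_of_lt_pi
    · positivity
    · rw [hx, div_div, div_lt_iff₀ (by positivity)]
      nlinarith [Real.pi_pos]
  have h := sum_cos_mul x (N - 1)
  -- For this `x` the last angle is `x / 2` short of a multiple of `π`, so `sin (x / 2)` factors out
  -- of the whole identity.
  have h1 : (((N - 1 : ℕ) : ℝ) + 1 / 2) * x = r * Real.pi - x / 2 := by
    rw [Nat.cast_sub (by omega), hx]; field_simp; push_cast; ring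
  rw [h1, Real.sin_sub, Real.sin_nat_mul_pi, Real.cos_nat_mul_pi] at h
  have : 2 * Real.sin (x / 2) * (∑ j ∈ Icc 1 (N - 1), Real.cos (j * x) - (-1 - (-1) ^ r) / 2)
      = 0 := by
    rw [mul_sub, h]; ring
  have := (mul_eq_zero.mp this).resolve_left (by positivity)
  linarith

/-- Product-to-sum gives cosine sums of frequencies `k` and `k + 2`. These have equal parity and
cancel, except that for `k = 0` the first one degenerates to `g + 1`. -/
lemma sum_sin_mul_sin (g : ℕ) {k : ℕ} (hk : k ≤ g) :
    ∑ j ∈ Icc 1 (g + 1), Real.sin (Real.pi * j / (g + 2)) *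
      Real.sin (Real.pi * j * (k + 1) / (g + 2)) = if k = 0 then ((g : ℝ) + 2) / 2 else 0 := by
  have hN : ((g + 2 : ℕ) : ℝ) = (g : ℝ) + 2 := by push_cast; ring
  have key : ∀ j : ℕ, Real.sin (Real.pi * j / (g + 2)) *
      Real.sin (Real.pi * j * (k + 1) / (g + 2)) =
      (Real.cos (j * (Real.pi * k / (g + 2 : ℕ)))
        - Real.cos (j * (Real.pi * (k + 2 : ℕ) / (g + 2 : ℕ)))) / 2 := by
    intro j
    have h1 : (j * (Real.pi * k / (g + 2 : ℕ)) : ℝ)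
        = Real.pi * j * (k + 1) / (g + 2) - Real.pi * j / (g + 2) := by
      rw [hN]; ring
    have h2 : (j * (Real.pi * (k + 2 : ℕ) / (g + 2 : ℕ)) : ℝ)
        = Real.pi * j * (k + 1) / (g + 2) + Real.pi * j / (g + 2) := by
      rw [hN]; push_cast; ring
    rw [h1, h2, Real.cos_sub, Real.cos_add]; ring
  simp_rw [key]
  rw [← Finset.sum_div, Finset.sum_sub_distrib]
  have h2 := sum_cos_pi_mul_div (N := g + 2) (r := k + 2) (by omega) (by omega)
  rw [show g + 2 - 1 = g + 1 by omega] at h2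
  rw [h2]
  split_ifs with h0
  · subst h0
    simp
    ring
  · have h1 := sum_cos_pi_mul_div (N := g + 2) (r := k) (by omega) (by omega)
    rw [show g + 2 - 1 = g + 1 by omega] at h1
    rw [h1, pow_add]; ring

lemma sin_pi_mul_top (g j : ℕ) :
    Real.sin (Real.pi * j * ((g + 1 : ℕ) + 1) / ((g : ℝ) + 2)) = 0 := by
  have : Real.pi * j * ((g + 1 : ℕ) + 1) / ((g : ℝ) + 2) = j * Real.pi := by
    field_simp; push_cast; ring
  rw [this, Real.sin_nat_mul_pi]

/-- The spectral decomposition of the walk counts. -/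
lemma stripWalks_eq_sum {g : ℕ} (hg : 1 ≤ g) (n : ℕ) {k : ℕ} (hk : k ≤ g + 1) :
    (stripWalks g n k : ℝ) = 2 / ((g : ℝ) + 2) * ∑ j ∈ Icc 1 (g + 1),
      Real.sin (Real.pi * j / (g + 2)) * Real.sin (Real.pi * j * (k + 1) / (g + 2)) *
        (2 * Real.cos (Real.pi * j / (g + 2))) ^ n := by
  -- The range includes the wall `k = g + 1`, where both sides vanish, so that the recursion at `k =
  -- g` needs no separate case.
  have hN : (g : ℝ) + 2 ≠ 0 := by positivity
  induction n generalizing k with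
  | zero =>
    rcases Nat.lt_or_ge g k with h | h
    · obtain rfl : k = g + 1 := by omega
      simp_rw [stripWalks_of_gap_lt _ h, sin_pi_mul_top]
      simp
    simp only [pow_zero, mul_one, sum_sin_mul_sin g h, stripWalks]
    split_ifs
    · simp; field_simp
    · simp
  | succ n ih =>
    rcases Nat.lt_or_ge g k with h | h
    · obtain rfl : k = g + 1 := by omega
      simp_rw [stripWalks_of_gap_lt _ h, sin_pi_mul_top]
      simp
    cases k with
    | zero =>
      rw [stripWalks, ih (k := 1) (by omega)]
      congr 1
      refine Finset.sum_congr rfl fun j _ => ?_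
      have h1 : Real.pi * j * ((1 : ℕ) + 1) / ((g : ℝ) + 2) = 2 * (Real.pi * j / (g + 2)) := by
        push_cast; ring
      have h2 : Real.pi * j * ((0 : ℕ) + 1) / ((g : ℝ) + 2) = Real.pi * j / (g + 2) := by
        push_cast; ring
      rw [h1, h2, Real.sin_two_mul]; ring
    | succ k =>
      rw [stripWalks, if_pos h, Nat.cast_add, ih (k := k) (by omega), ih (k := k + 2) (by omega), ← mul_add,
        ← Finset.sum_add_distrib]
      congr 1
      refine Finset.sum_congr rfl fun j _ => ?_
      set t := Real.pi * j / ((g : ℝ) + 2) with ht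
      set u := Real.pi * j * ((k + 1 : ℕ) + 1) / ((g : ℝ) + 2) with hu
      have h1 : Real.pi * j * (k + 1) / ((g : ℝ) + 2) = u - t := by
        rw [ht, hu]; push_cast; ring
      have h2 : Real.pi * j * ((k + 2 : ℕ) + 1) / ((g : ℝ) + 2) = u + t := by
        rw [ht, hu]; push_cast; ring
      -- The eigenvalue equation `sin (u - t) + sin (u + t) = 2 cos t sin u`.
      rw [h1, h2, Real.sin_sub, Real.sin_add]; ring

end MiningGame

/-! ### Reachable states and interior lattice paths. -/

namespace MiningGame

open Finset

/-- The paths of a relation `R` from `a` to `b`, as lists of vertices. -/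
def pathLists {α : Type*} (R : α → α → Prop) (a b : α) : Set (List α) :=
  {w | w.head? = some a ∧ w.getLast? = some b ∧ w.IsChain R}

/-- Peeling off the last vertex matches the last-step recursion of `stripWalks`. -/
lemma mem_pathLists_iff {α : Type*} {R : α → α → Prop} {a b : α} {w : List α} :
    w ∈ pathLists R a b ↔
      (a = b ∧ w = [a]) ∨ ∃ y, R y b ∧ ∃ v ∈ pathLists R a y, v ++ [b] = w := by
  constructor
  · rintro ⟨hh, hl, hc⟩
    obtain ⟨v, rfl⟩ : ∃ v, w = v ++ [b] := by
      rw [List.getLast?_eq_some_iff] at hl; exact hl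
    rcases List.eq_nil_or_concat v with rfl | ⟨u, y, rfl⟩
    · left; simp at hh; simp [hh]
    · right
      simp only [List.concat_eq_append] at *
      rw [List.isChain_append] at hc
      refine ⟨y, hc.2.2 y (by simp) b (by simp), _, ⟨?_, by simp, hc.1⟩, rfl⟩
      rw [List.head?_append_of_ne_nil _ (by simp)] at hh
      exact hh
  · rintro (⟨rfl, rfl⟩ | ⟨y, hy, v, ⟨hh, hl, hc⟩, rfl⟩)
    · simp [pathLists]
    · refine ⟨by simp [hh], by simp, ?_⟩
      rw [List.isChain_append]
      refine ⟨hc, by simp, ?_⟩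
      intro z hz z' hz'
      simp [hl] at hz hz'
      subst hz hz'
      exact hy

lemma pathLists_induction {α : Type*} {R : α → α → Prop} {a : α} {P : α → Prop} (ha : P a)
    (hP : ∀ y z, P y → R y z → P z) {b : α} {w : List α} (hw : w ∈ pathLists R a b) : P b := by
  induction w using List.reverseRecOn generalizing b with
  | nil => simp [pathLists] at hw
  | append_singleton w c ih =>
    rcases mem_pathLists_iff.mp hw with ⟨rfl, -⟩ | ⟨y, hy, v, hv, hvw⟩
    · exact ha
    · obtain ⟨rfl, -⟩ := List.append_inj' hvw rfl
      exact hP _ _ (ih hv) hy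

section

variable {A : CapPolicy} {g : ℕ}

lemma CapPolicy.HasConstantGapTolerance.eq_false (hA : A.HasConstantGapTolerance g) (l : ℕ) {k : ℕ}
    (hk : k < g) : A.C l (l + k) = false := by
  by_contra h
  exact absurd ((hA l).2 (show k ∈ {k : ℕ | A.C l (l + k) = true} by simpa using h)) (by omega)

lemma CapPolicy.HasConstantGapTolerance.eq_true (hA : A.HasConstantGapTolerance g) (l : ℕ) :
    A.C l (l + g) = true := (hA l).1

lemma CapPolicy.HasConstantGapTolerance.eq_true_iff (hA : A.HasConstantGapTolerance g) (l : ℕ)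
    {k : ℕ} (hk : k ≤ g) : A.C l (l + k) = true ↔ k = g := by
  rcases hk.lt_or_eq with h | rfl
  · simp [hA.eq_false l h, h.ne]
  · simp [hA.eq_true l]

lemma next₁_frontier_zero (l : ℕ) : next₁ frontier (l, l) = (0, 0) := by
  simp [next₁, frontier]

lemma next₁_frontier_succ (l k : ℕ) :
    next₁ frontier (l, l + (k + 1)) = (l + 1, l + (k + 1)) := by
  simp [next₁, frontier]

lemma next₂_of_lt (hA : A.HasConstantGapTolerance g) (l : ℕ) {k : ℕ} (hk : k < g) :
    next₂ A (l, l + k) = (l, l + k + 1) := by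
  simp [next₂, hA.eq_false l hk]

lemma next₂_gap (hA : A.HasConstantGapTolerance g) (hs : A.s = 0) (l : ℕ) :
    next₂ A (l, l + g) = (0, 0) := by
  simp [next₂, hA.eq_true l, hs]

lemma states_frontier (hg : 1 ≤ g) (hA : A.HasConstantGapTolerance g) (hs : A.s = 0) :
    states A frontier = {m | ∃ l k : ℕ, k ≤ g ∧ m = (l, l + k)} := by
  ext m
  constructor
  · rintro ⟨m₀, h0, hm⟩
    have h0' : m₀ = (0, 0) := by simpa [hs, frontier] using h0
    induction hm with
    | refl => exact ⟨0, 0, by omega, h0'⟩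
    | tail _ hstep ih =>
      obtain ⟨l, k, hk, rfl⟩ := ih
      rcases hstep with rfl | rfl
      · cases k with
        | zero => exact ⟨0, 0, by omega, next₁_frontier_zero l⟩
        | succ k =>
          exact ⟨l + 1, k, by omega, by rw [next₁_frontier_succ, Prod.mk.injEq]; omega⟩
      · rcases hk.lt_or_eq with h | rfl
        · exact ⟨l, k + 1, h, next₂_of_lt hA l h⟩
        · exact ⟨0, 0, by omega, next₂_gap hA hs l⟩
  · rintro ⟨l, k, hk, rfl⟩
    refine ⟨(0, 0), Or.inl (by rw [hs]), ?_⟩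
    have up : ∀ l k : ℕ, k ≤ g → Relation.ReflTransGen
        (fun x y => y = next₁ frontier x ∨ y = next₂ A x) (l, l) (l, l + k) := by
      intro l k hk
      induction k with
      | zero => exact .refl
      | succ k ih =>
        exact (ih (by omega)).tail (Or.inr (next₂_of_lt hA l (by omega)).symm)
    -- Go along the diagonal to `(l, l)`, then climb. Each diagonal move passes through gap `1`,
    -- which is where `1 ≤ g` enters.
    refine Relation.ReflTransGen.trans ?_ (up l k hk)
    induction l with
    | zero => exact .refl
    | succ l ih =>
      exact (ih.trans (up l 1 hg)).tail (Or.inl (next₁_frontier_succ l 0).symm)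

lemma exists_gap_of_mem_pathLists (hA : A.HasConstantGapTolerance g) {x : ℕ × ℕ}
    {w : List (ℕ × ℕ)} (hw : w ∈ pathLists (InteriorStep A frontier) (0, 0) x) :
    ∃ l k : ℕ, k ≤ g ∧ x = (l, l + k) := by
  refine pathLists_induction (P := fun x => ∃ l k : ℕ, k ≤ g ∧ x = (l, l + k))
    ⟨0, 0, by omega, rfl⟩ ?_ hw
  rintro _ z ⟨l, k, hk, rfl⟩ (⟨hc, rfl⟩ | ⟨hc, rfl⟩)
  · have : ¬ l + k ≤ l := by simpa [frontier] using hc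
    exact ⟨l + 1, k - 1, by omega, Prod.ext rfl (show l + k = l + 1 + (k - 1) by omega)⟩
  · have : k ≠ g := by rintro rfl; simp [hA.eq_true l] at hc
    exact ⟨l, k + 1, by omega, rfl⟩

lemma pathLists_eq_empty (hA : A.HasConstantGapTolerance g) {a b : ℕ} (h : b < a ∨ a + g < b) :
    pathLists (InteriorStep A frontier) (0, 0) (a, b) = ∅ := by
  rw [Set.eq_empty_iff_forall_notMem]
  intro w hw
  obtain ⟨l, k, hk, hx⟩ := exists_gap_of_mem_pathLists hA hw
  simp only [Prod.mk.injEq] at hx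
  omega

lemma pathLists_zero : pathLists (InteriorStep A frontier) (0, 0) (0, 0) = {[(0, 0)]} := by
  ext w
  rw [mem_pathLists_iff]
  simp [InteriorStep]

lemma append_singleton_injOn {α : Type*} (b : α) (s : Set (List α)) :
    Set.InjOn (fun v => v ++ [b]) s := fun _ _ _ _ h => (List.append_inj' h rfl).1

lemma append_image_disjoint {α : Type*} {R : α → α → Prop} {a b y z : α} (h : y ≠ z) :
    Disjoint ((fun v => v ++ [b]) '' pathLists R a y) ((fun v => v ++ [b]) '' pathLists R a z) := by
  rw [Set.disjoint_left]
  rintro _ ⟨v, hv, rfl⟩ ⟨u, hu, huv⟩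
  obtain ⟨rfl, -⟩ := List.append_inj' huv rfl
  exact h (Option.some.inj (hv.2.1.symm.trans hu.2.1))

/-- Induction on the number of steps. Finiteness is carried along because `Set.ncard` is additive
only on disjoint finite sets. -/
lemma pathLists_finite_and_ncard (hA : A.HasConstantGapTolerance g) (n : ℕ) :
    ∀ l k : ℕ, k ≤ g → 2 * l + k = n →
      (pathLists (InteriorStep A frontier) (0, 0) (l, l + k)).Finite ∧
      (pathLists (InteriorStep A frontier) (0, 0) (l, l + k)).ncard = stripWalks g n k := by
  induction n with
  | zero =>
    intro l k _ h
    obtain ⟨rfl, rfl⟩ : l = 0 ∧ k = 0 := by omega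
    simp [pathLists_zero, stripWalks]
  | succ n ih =>
    -- Gaps above `g` are included, since the predecessor of gap `k + 2` may lie outside the strip;
    -- both counts are then zero.
    have ih' : ∀ l k : ℕ, 2 * l + k = n →
      (pathLists (InteriorStep A frontier) (0, 0) (l, l + k)).Finite ∧
      (pathLists (InteriorStep A frontier) (0, 0) (l, l + k)).ncard = stripWalks g n k := by
      intro l k h
      rcases Nat.lt_or_ge g k with hk | hk
      · rw [pathLists_eq_empty hA (by omega), stripWalks_of_gap_lt n hk]
        simp
      · exact ih l k hk h
    intro l k hk h
    rcases l with - | l <;> rcases k with - | k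
    · omega
    · have hset : pathLists (InteriorStep A frontier) (0, 0) (0, 0 + (k + 1)) =
          (fun v => v ++ [(0, 0 + (k + 1))]) ''
            pathLists (InteriorStep A frontier) (0, 0) (0, 0 + k) := by
        ext w
        rw [mem_pathLists_iff]
        constructor
        · rintro (⟨h, -⟩ | ⟨⟨y1, y2⟩, ⟨-, hy⟩ | ⟨-, hy⟩, hv⟩)
          · simp at h
          · simp at hy
          · simp only [Prod.mk.injEq] at hy
            obtain ⟨rfl, rfl⟩ : y1 = 0 ∧ y2 = 0 + k := by omega
            exact hv
        · rintro hv
          exact Or.inr ⟨(0, 0 + k), Or.inr ⟨hA.eq_false 0 (by omega), rfl⟩, hv⟩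
      rw [hset, Set.InjOn.ncard_image (append_singleton_injOn _ _)]
      refine ⟨(ih' 0 k (by omega)).1.image _, ?_⟩
      -- For `l = 0` there is no predecessor of gap `k + 2`; the corresponding walk count vanishes
      -- because `n = k` steps cannot reach it.
      rw [(ih' 0 k (by omega)).2, stripWalks, if_pos hk,
        stripWalks_of_lt g (show n < k + 2 by omega), add_zero]
    · have hset : pathLists (InteriorStep A frontier) (0, 0) (l + 1, l + 1 + 0) =
          (fun v => v ++ [(l + 1, l + 1 + 0)]) ''
            pathLists (InteriorStep A frontier) (0, 0) (l, l + 1) := by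
        ext w
        rw [mem_pathLists_iff]
        constructor
        · rintro (⟨h, -⟩ | ⟨⟨y1, y2⟩, ⟨-, hy⟩ | ⟨-, hy⟩, hv⟩)
          · simp at h
          · simp only [Prod.mk.injEq] at hy
            obtain ⟨rfl, rfl⟩ : y1 = l ∧ y2 = l + 1 := by omega
            exact hv
          · simp only [Prod.mk.injEq] at hy
            obtain ⟨v, hv, -⟩ := hv
            rw [pathLists_eq_empty hA (by omega)] at hv
            exact hv.elim
        · rintro hv
          exact Or.inr ⟨(l, l + 1), Or.inl ⟨by simp [frontier], rfl⟩, hv⟩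
      rw [hset, Set.InjOn.ncard_image (append_singleton_injOn _ _)]
      refine ⟨(ih' l 1 (by omega)).1.image _, ?_⟩
      rw [(ih' l 1 (by omega)).2, stripWalks]
    · have hset : pathLists (InteriorStep A frontier) (0, 0) (l + 1, l + 1 + (k + 1)) =
          ((fun v => v ++ [(l + 1, l + 1 + (k + 1))]) ''
            pathLists (InteriorStep A frontier) (0, 0) (l + 1, l + 1 + k)) ∪
          ((fun v => v ++ [(l + 1, l + 1 + (k + 1))]) ''
            pathLists (InteriorStep A frontier) (0, 0) (l, l + (k + 2))) := by
        ext w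
        rw [mem_pathLists_iff]
        constructor
        · rintro (⟨h, -⟩ | ⟨⟨y1, y2⟩, ⟨-, hy⟩ | ⟨-, hy⟩, hv⟩)
          · simp at h
          · simp only [Prod.mk.injEq] at hy
            obtain ⟨rfl, rfl⟩ : y1 = l ∧ y2 = l + (k + 2) := by omega
            exact Or.inr hv
          · simp only [Prod.mk.injEq] at hy
            obtain ⟨rfl, rfl⟩ : y1 = l + 1 ∧ y2 = l + 1 + k := by omega
            exact Or.inl hv
        · rintro (hv | hv)
          · exact Or.inr ⟨_, Or.inr ⟨hA.eq_false (l + 1) (by omega), rfl⟩, hv⟩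
          · exact Or.inr ⟨(l, l + (k + 2)), Or.inl ⟨by simp [frontier],
              Prod.ext rfl (show l + 1 + (k + 1) = l + (k + 2) by omega)⟩, hv⟩
      have h1 := ih' (l + 1) k (by omega)
      have h2 := ih' l (k + 2) (by omega)
      rw [hset, Set.ncard_union_eq (append_image_disjoint (by simp)) (h1.1.image _) (h2.1.image _),
        Set.InjOn.ncard_image (append_singleton_injOn _ _),
        Set.InjOn.ncard_image (append_singleton_injOn _ _), h1.2, h2.2, stripWalks, if_pos hk]
      exact ⟨(h1.1.image _).union (h2.1.image _), rfl⟩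

lemma pathCount_frontier (hA : A.HasConstantGapTolerance g) (l : ℕ) {k : ℕ} (hk : k ≤ g) :
    pathCount A frontier l (l + k) = stripWalks g (2 * l + k) k :=
  (pathLists_finite_and_ncard hA _ l k hk rfl).2

end

end MiningGame

/-! ### Stationary weights, their column sums and `Γ`. -/

namespace MiningGame

open Finset

section Weight

/-- The unnormalized stationary weight of the state `(l, l + k)`. -/
noncomputable def weight (g : ℕ) (p₁ p₂ : ℝ) (l k : ℕ) : ℝ :=
  stripWalks g (2 * l + k) k * p₁ ^ l * p₂ ^ (l + k)

variable {g : ℕ} {p₁ p₂ : ℝ}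

lemma weight_nonneg (hp₁ : 0 < p₁) (hp₂ : 0 < p₂) (l k : ℕ) : 0 ≤ weight g p₁ p₂ l k := by
  unfold weight; positivity

lemma weight_zero_zero : weight g p₁ p₂ 0 0 = 1 := by simp [weight, stripWalks]

lemma weight_of_gap_lt (l : ℕ) {k : ℕ} (hk : g < k) : weight g p₁ p₂ l k = 0 := by
  simp [weight, stripWalks_of_gap_lt _ hk]

/-- Together with `weight_zero_succ` and `weight_succ_succ`, these are the balance equations at all
states other than `(0, 0)`. -/
lemma weight_succ_zero (l : ℕ) : weight g p₁ p₂ (l + 1) 0 = p₁ * weight g p₁ p₂ l 1 := by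
  simp only [weight, show 2 * (l + 1) + 0 = (2 * l + 1) + 1 by ring, stripWalks]
  ring

lemma weight_zero_succ {k : ℕ} (hk : k + 1 ≤ g) :
    weight g p₁ p₂ 0 (k + 1) = p₂ * weight g p₁ p₂ 0 k := by
  rw [weight, weight, show 2 * 0 + (k + 1) = k + 1 by ring, stripWalks_succ_succ _ hk,
    stripWalks_of_lt g (show k < k + 2 by omega), show 2 * 0 + k = k by ring]
  push_cast
  ring

lemma weight_succ_succ (l : ℕ) {k : ℕ} (hk : k + 1 ≤ g) :
    weight g p₁ p₂ (l + 1) (k + 1)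
      = p₁ * weight g p₁ p₂ l (k + 2) + p₂ * weight g p₁ p₂ (l + 1) k := by
  rw [weight, weight, weight, show 2 * (l + 1) + (k + 1) = (2 * (l + 1) + k) + 1 by ring,
    stripWalks_succ_succ _ hk, show 2 * l + (k + 2) = 2 * (l + 1) + k by ring]
  push_cast
  ring

lemma four_mul_le_one (hp : p₁ + p₂ = 1) : 4 * (p₁ * p₂) ≤ 1 := by
  nlinarith [sq_nonneg (p₁ - p₂)]

lemma cos_sq_lt_one {j : ℕ} (hj : j ∈ Icc 1 (g + 1)) :
    Real.cos (Real.pi * j / (g + 2)) ^ 2 < 1 := by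
  rw [Finset.mem_Icc] at hj
  have h1 : (1 : ℝ) ≤ j := by exact_mod_cast hj.1
  have h2 : (j : ℝ) ≤ g + 1 := by exact_mod_cast hj.2
  have hs : 0 < Real.sin (Real.pi * j / (g + 2)) := by
    apply Real.sin_pos_of_pos_of_lt_pi
    · have := Real.pi_pos
      positivity
    · rw [div_lt_iff₀ (by positivity)]
      exact mul_lt_mul_of_pos_left (by linarith) Real.pi_pos
  nlinarith [Real.sin_sq_add_cos_sq (Real.pi * j / (g + 2))]

/-- Strictness must come from the cosine: `4 p₁ p₂` equals `1` when `p₁ = p₂`. -/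
lemma ratio_lt_one (hp₁ : 0 < p₁) (hp₂ : 0 < p₂) (hp : p₁ + p₂ = 1) {j : ℕ}
    (hj : j ∈ Icc 1 (g + 1)) : 4 * Real.cos (Real.pi * j / (g + 2)) ^ 2 * p₁ * p₂ < 1 := by
  have h1 := cos_sq_lt_one hj
  have h2 := four_mul_le_one hp
  have h3 : 0 < p₁ * p₂ := by positivity
  nlinarith

lemma ratio_nonneg (hp₁ : 0 < p₁) (hp₂ : 0 < p₂) (c : ℝ) : 0 ≤ 4 * c ^ 2 * p₁ * p₂ := by
  positivity

lemma weight_eq_sum (hg : 1 ≤ g) (l : ℕ) {k : ℕ} (hk : k ≤ g) :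
    weight g p₁ p₂ l k = ∑ j ∈ Icc 1 (g + 1), 2 / ((g : ℝ) + 2) *
      (Real.sin (Real.pi * j / (g + 2)) * Real.sin (Real.pi * j * (k + 1) / (g + 2)) *
        (2 * Real.cos (Real.pi * j / (g + 2)) * p₂) ^ k) *
        (4 * Real.cos (Real.pi * j / (g + 2)) ^ 2 * p₁ * p₂) ^ l := by
  rw [weight, stripWalks_eq_sum hg _ (by omega), Finset.mul_sum, Finset.sum_mul, Finset.sum_mul]
  refine Finset.sum_congr rfl fun j _ => ?_
  rw [pow_add, pow_mul, pow_add, mul_pow _ p₂, mul_pow _ p₂, mul_pow _ p₁, mul_pow 2 _ 2]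
  norm_num
  ring

/-- The total weight of the states with gap `k`. -/
noncomputable def columnWeight (g : ℕ) (p₁ p₂ : ℝ) (k : ℕ) : ℝ := ∑' l, weight g p₁ p₂ l k

lemma hasSum_weight_spectral (hg : 1 ≤ g) (hp₁ : 0 < p₁) (hp₂ : 0 < p₂) (hp : p₁ + p₂ = 1) {k : ℕ}
    (hk : k ≤ g) : HasSum (fun l => weight g p₁ p₂ l k) (∑ j ∈ Icc 1 (g + 1), 2 / ((g : ℝ) + 2) *
      (Real.sin (Real.pi * j / (g + 2)) * Real.sin (Real.pi * j * (k + 1) / (g + 2)) *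
        (2 * Real.cos (Real.pi * j / (g + 2)) * p₂) ^ k) *
        (1 - 4 * Real.cos (Real.pi * j / (g + 2)) ^ 2 * p₁ * p₂)⁻¹) := by
  simp_rw [weight_eq_sum hg _ hk]
  exact hasSum_sum fun j hj => (hasSum_geometric_of_lt_one (ratio_nonneg hp₁ hp₂ _)
    (ratio_lt_one hp₁ hp₂ hp hj)).mul_left _

/-- The factor `l + 1 + c` is the reward length `ℓ₂ + 1` on the column of gap `c`; the case `c = 0`
serves player 1. -/
lemma hasSum_add_mul_geometric {r : ℝ} (h0 : 0 ≤ r) (h1 : r < 1) (c : ℝ) :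
    HasSum (fun l : ℕ => r ^ l * (l + 1 + c)) ((c * (1 - r) + 1) / (1 - r) ^ 2) := by
  have hr : 1 - r ≠ 0 := by linarith
  have h := (hasSum_coe_mul_geometric_of_norm_lt_one
    (show ‖r‖ < 1 by rwa [Real.norm_of_nonneg h0])).add
    ((hasSum_geometric_of_lt_one h0 h1).mul_left (1 + c))
  have e1 : (fun l : ℕ => r ^ l * (l + 1 + c)) = fun l : ℕ => l * r ^ l + (1 + c) * r ^ l := by
    funext l; ring
  have e2 : (c * (1 - r) + 1) / (1 - r) ^ 2 = r / (1 - r) ^ 2 + (1 + c) * (1 - r)⁻¹ := by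
    field_simp; ring
  rw [e1, e2]
  exact h

lemma hasSum_weight_mul_spectral (hg : 1 ≤ g) (hp₁ : 0 < p₁) (hp₂ : 0 < p₂) (hp : p₁ + p₂ = 1)
    {k : ℕ} (hk : k ≤ g) :
    HasSum (fun l : ℕ => weight g p₁ p₂ l k * (l + 1 + k)) (∑ j ∈ Icc 1 (g + 1),
      2 / ((g : ℝ) + 2) *
      (Real.sin (Real.pi * j / (g + 2)) * Real.sin (Real.pi * j * (k + 1) / (g + 2)) *
        (2 * Real.cos (Real.pi * j / (g + 2)) * p₂) ^ k) *
        ((k * (1 - 4 * Real.cos (Real.pi * j / (g + 2)) ^ 2 * p₁ * p₂) + 1) /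
          (1 - 4 * Real.cos (Real.pi * j / (g + 2)) ^ 2 * p₁ * p₂) ^ 2)) := by
  simp_rw [weight_eq_sum hg _ hk, Finset.sum_mul, mul_assoc (_ * _) (_ ^ _) (_ + _)]
  exact hasSum_sum fun j hj => (hasSum_add_mul_geometric (ratio_nonneg hp₁ hp₂ _)
    (ratio_lt_one hp₁ hp₂ hp hj) k).mul_left _

lemma summable_weight (hg : 1 ≤ g) (hp₁ : 0 < p₁) (hp₂ : 0 < p₂) (hp : p₁ + p₂ = 1) (k : ℕ) :
    Summable (fun l => weight g p₁ p₂ l k) := by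
  rcases Nat.lt_or_ge g k with h | h
  · simp_rw [weight_of_gap_lt _ h]
    exact summable_zero
  · exact (hasSum_weight_spectral hg hp₁ hp₂ hp h).summable

lemma hasSum_weight (hg : 1 ≤ g) (hp₁ : 0 < p₁) (hp₂ : 0 < p₂) (hp : p₁ + p₂ = 1) (k : ℕ) :
    HasSum (fun l => weight g p₁ p₂ l k) (columnWeight g p₁ p₂ k) :=
  (summable_weight hg hp₁ hp₂ hp k).hasSum

lemma columnWeight_zero (hg : 1 ≤ g) (hp₁ : 0 < p₁) (hp₂ : 0 < p₂) (hp : p₁ + p₂ = 1) :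
    columnWeight g p₁ p₂ 0 = 1 + p₁ * columnWeight g p₁ p₂ 1 := by
  rw [columnWeight, (summable_weight hg hp₁ hp₂ hp 0).tsum_eq_zero_add, weight_zero_zero]
  simp_rw [weight_succ_zero, tsum_mul_left]
  rfl

lemma columnWeight_succ (hg : 1 ≤ g) (hp₁ : 0 < p₁) (hp₂ : 0 < p₂) (hp : p₁ + p₂ = 1) {k : ℕ}
    (hk : k + 1 ≤ g) : columnWeight g p₁ p₂ (k + 1)
      = p₁ * columnWeight g p₁ p₂ (k + 2) + p₂ * columnWeight g p₁ p₂ k := by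
  have hS := summable_weight hg hp₁ hp₂ hp
  rw [columnWeight, (hS (k + 1)).tsum_eq_zero_add, weight_zero_succ hk]
  simp_rw [weight_succ_succ _ hk]
  rw [((hS (k + 2)).mul_left p₁).tsum_add (((summable_nat_add_iff 1).mpr (hS k)).mul_left p₂),
    tsum_mul_left, tsum_mul_left, columnWeight, columnWeight, (hS k).tsum_eq_zero_add]
  ring

/-- The weight that flows back to `(0, 0)` is `1`. -/
lemma columnWeight_return (hg : 1 ≤ g) (hp₁ : 0 < p₁) (hp₂ : 0 < p₂) (hp : p₁ + p₂ = 1) :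
    p₁ * columnWeight g p₁ p₂ 0 + p₂ * columnWeight g p₁ p₂ g = 1 := by
  set G := columnWeight g p₁ p₂ with hG
  have hlast : G (g + 1) = 0 := by
    simp [hG, columnWeight, weight_of_gap_lt _ (Nat.lt_succ_self g)]
  have h1 : ∑ k ∈ range (g + 1), G k = ∑ k ∈ range g, G (k + 1) + G 0 := sum_range_succ' _ _
  have h2 : ∑ k ∈ range (g + 1), G k = ∑ k ∈ range g, G k + G g := sum_range_succ _ _
  have h3 : ∑ k ∈ range (g + 1), G (k + 1) = ∑ k ∈ range g, G (k + 2) + G 1 :=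
    sum_range_succ' _ _
  have h4 : ∑ k ∈ range (g + 1), G (k + 1) = ∑ k ∈ range g, G (k + 1) + G (g + 1) :=
    sum_range_succ _ _
  -- Summing the recursion over all gaps telescopes by `p₁ + p₂ = 1`: only the source `1` at `(0,
  -- 0)` and the losses at gaps `0` and `g` survive.
  have h5 : ∑ k ∈ range g, G (k + 1) = p₁ * ∑ k ∈ range g, G (k + 2) + p₂ * ∑ k ∈ range g, G k := by
    rw [Finset.mul_sum, Finset.mul_sum, ← Finset.sum_add_distrib]
    exact Finset.sum_congr rfl fun k hk =>
      columnWeight_succ hg hp₁ hp₂ hp (by simpa using hk)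
  have h6 : G 0 = 1 + p₁ * G 1 := columnWeight_zero hg hp₁ hp₂ hp
  have e1 : ∑ k ∈ range g, G (k + 1) = ∑ k ∈ range g, G k + G g - G 0 := by linarith
  have e2 : ∑ k ∈ range g, G (k + 2) = ∑ k ∈ range g, G k + G g - G 0 - G 1 := by linarith
  rw [e1, e2] at h5
  obtain rfl : p₂ = 1 - p₁ := by linarith
  linarith

lemma sum_columnWeight (hg : 1 ≤ g) (hp₁ : 0 < p₁) (hp₂ : 0 < p₂) (hp : p₁ + p₂ = 1) :
    ∑ k ∈ range (g + 1), columnWeight g p₁ p₂ k = 2 / ((g : ℝ) + 2) * Gam g p₁ p₂ := by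
  have : ∀ k ∈ range (g + 1), columnWeight g p₁ p₂ k = _ := fun k hk =>
    (hasSum_weight_spectral hg hp₁ hp₂ hp (by rw [Finset.mem_range] at hk; omega)).tsum_eq
  rw [Finset.sum_congr rfl this, Finset.sum_comm, Gam, Finset.mul_sum]
  refine Finset.sum_congr rfl fun j _ => ?_
  rw [Finset.mul_sum, Finset.mul_sum]
  refine Finset.sum_congr rfl fun k _ => ?_
  rw [mul_pow, mul_pow]
  ring

/-- The sign is not visible in the trigonometric sum; it is read off from the nonnegative column
weights, the one of gap `0` being at least `1`. -/
lemma Gam_pos (hg : 1 ≤ g) (hp₁ : 0 < p₁) (hp₂ : 0 < p₂) (hp : p₁ + p₂ = 1) :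
    0 < Gam g p₁ p₂ := by
  have h0 : ∀ k, 0 ≤ columnWeight g p₁ p₂ k := fun k =>
    tsum_nonneg fun l => weight_nonneg hp₁ hp₂ l k
  have h1 : 0 < columnWeight g p₁ p₂ 0 := by
    rw [columnWeight_zero hg hp₁ hp₂ hp]
    have := mul_nonneg hp₁.le (h0 1)
    linarith
  have h2 : columnWeight g p₁ p₂ 0 ≤ ∑ k ∈ range (g + 1), columnWeight g p₁ p₂ k :=
    Finset.single_le_sum (fun k _ => h0 k) (by simp)
  rw [sum_columnWeight hg hp₁ hp₂ hp] at h2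
  exact pos_of_mul_pos_right (h1.trans_le h2) (by positivity)

end Weight

end MiningGame

/-! ### Sums over fibers and over the state space. -/

namespace MiningGame

open Finset

section Chain

variable {α : Type*}

open Classical in
/-- The extension by `0` of a function on a set. -/
noncomputable def zeroExtend {S : Set α} (π : S → ℝ) (x : α) : ℝ :=
  if h : x ∈ S then π ⟨x, h⟩ else 0

lemma zeroExtend_of_mem {S : Set α} (π : S → ℝ) {x : α} (h : x ∈ S) :
    zeroExtend π x = π ⟨x, h⟩ := dif_pos h

lemma zeroExtend_of_notMem {S : Set α} (π : S → ℝ) {x : α} (h : x ∉ S) :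
    zeroExtend π x = 0 := dif_neg h

/-- The inflow into `y` along a map under which `x₀` is the only preimage of `y`. -/
lemma hasSum_fiber [DecidableEq α] {S : Set α} (π : S → ℝ) (p : ℝ) {f : α → α} {x₀ y : α}
    (h₀ : x₀ ∈ S → f x₀ = y) (huniq : ∀ x ∈ S, f x = y → x = x₀) :
    HasSum (fun m : S => π m * if f m.1 = y then p else 0) (p * zeroExtend π x₀) := by
  by_cases h : x₀ ∈ S
  · have := hasSum_single (f := fun m : S => π m * if f m.1 = y then p else 0) ⟨x₀, h⟩ (by
      intro m hm
      rw [if_neg fun he => hm (Subtype.ext (huniq m.1 m.2 he)), mul_zero])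
    simpa [h₀ h, zeroExtend_of_mem π h, mul_comm] using this
  · rw [zeroExtend_of_notMem π h, mul_zero]
    convert (hasSum_zero : HasSum (fun _ : S => (0 : ℝ)) 0) using 2 with m
    rw [if_neg fun he => h (huniq m.1 m.2 he ▸ m.2), mul_zero]

lemma hasSum_fiber_empty [DecidableEq α] {S : Set α} (π : S → ℝ) (p : ℝ) {f : α → α} {y : α}
    (h : ∀ x ∈ S, f x ≠ y) :
    HasSum (fun m : S => π m * if f m.1 = y then p else 0) 0 := by
  convert (hasSum_zero : HasSum (fun _ : S => (0 : ℝ)) 0) using 2 with m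
  rw [if_neg (h m.1 m.2), mul_zero]

end Chain

lemma hasSum_of_eq {ι : Type*} {f f' : ι → ℝ} {a a' : ℝ} (h : HasSum f a)
    (hf : ∀ i, f' i = f i) (ha : a' = a) : HasSum f' a' := by
  rw [ha, funext hf]; exact h

section States

variable {A : CapPolicy} {g : ℕ}

lemma mem_states (hg : 1 ≤ g) (hA : A.HasConstantGapTolerance g) (hs : A.s = 0) (l : ℕ) {k : ℕ}
    (hk : k ≤ g) : (l, l + k) ∈ states A frontier := by
  rw [states_frontier hg hA hs]; exact ⟨l, k, hk, rfl⟩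

lemma notMem_states (hg : 1 ≤ g) (hA : A.HasConstantGapTolerance g) (hs : A.s = 0) (l : ℕ) {k : ℕ}
    (hk : g < k) : (l, l + k) ∉ states A frontier := by
  rw [states_frontier hg hA hs]
  rintro ⟨l', k', h, he⟩
  simp only [Prod.mk.injEq] at he
  omega

lemma exists_gap (hg : 1 ≤ g) (hA : A.HasConstantGapTolerance g) (hs : A.s = 0)
    {x : ℕ × ℕ} (hx : x ∈ states A frontier) : ∃ l k : ℕ, k ≤ g ∧ x = (l, l + k) := by
  rw [states_frontier hg hA hs] at hx; exact hx

/-- A sum over the states that is supported on the states with gap `k`. -/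
lemma hasSum_column (hg : 1 ≤ g) (hA : A.HasConstantGapTolerance g) (hs : A.s = 0) {k : ℕ}
    (hk : k ≤ g) (F : states A frontier → ℝ) (hF : ∀ m, m.1.2 ≠ m.1.1 + k → F m = 0) {s : ℝ}
    (h : HasSum (fun l => F ⟨(l, l + k), mem_states hg hA hs l hk⟩) s) : HasSum F s := by
  have hinj : Function.Injective
      (fun l => (⟨(l, l + k), mem_states hg hA hs l hk⟩ : states A frontier)) := by
    intro l l' h
    simp only [Subtype.mk.injEq, Prod.mk.injEq] at h
    exact h.1
  refine (hinj.hasSum_iff fun m hm => hF m fun he => hm ⟨m.1.1, ?_⟩).mp h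
  exact Subtype.ext (Prod.ext rfl he.symm)

/-- Only `g + 1` gaps occur, so a sum over the states is a finite sum of series in `l`. -/
lemma hasSum_states (hg : 1 ≤ g) (hA : A.HasConstantGapTolerance g) (hs : A.s = 0)
    (F : states A frontier → ℝ) {s : ℕ → ℝ}
    (h : ∀ k, ∀ hk : k ≤ g, HasSum (fun l => F ⟨(l, l + k), mem_states hg hA hs l hk⟩) (s k)) :
    HasSum F (∑ k ∈ range (g + 1), s k) := by
  have h1 : F = fun m => ∑ k ∈ range (g + 1), if m.1.2 = m.1.1 + k then F m else 0 := by
    funext m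
    obtain ⟨l, k, hk, hm⟩ := exists_gap hg hA hs m.2
    rw [Finset.sum_eq_single k]
    · simp [hm]
    · intro j _ hj
      rw [if_neg]
      rw [hm]; simp; omega
    · intro h; simp at h; omega
  rw [h1]
  refine hasSum_sum fun k hk => ?_
  have hk' : k ≤ g := by simp at hk; omega
  refine hasSum_column hg hA hs hk' _ (fun m hm => if_neg hm) ?_
  simpa using h k hk'

/-! ### Inflows, uniqueness and existence of the stationary distribution. -/

variable {p₁ p₂ : ℝ}

lemma hasSum_transition {π : states A frontier → ℝ} {m' : states A frontier} {a b : ℝ}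
    (h₁ : HasSum (fun m => π m * if next₁ frontier m.1 = m'.1 then p₁ else 0) a)
    (h₂ : HasSum (fun m => π m * if next₂ A m.1 = m'.1 then p₂ else 0) b) :
    HasSum (fun m => π m * transition A frontier p₁ p₂ m m') (a + b) := by
  simpa only [transition, mul_add] using h₁.add h₂

lemma next₁_eq_iff (hg : 1 ≤ g) (hA : A.HasConstantGapTolerance g) (hs : A.s = 0) {x : ℕ × ℕ}
    (hx : x ∈ states A frontier) (a b : ℕ) : next₁ frontier x = (a, b) ↔
      (x.1 = x.2 ∧ a = 0 ∧ b = 0) ∨ (x.1 < x.2 ∧ a = x.1 + 1 ∧ b = x.2) := by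
  obtain ⟨l, k, hk, rfl⟩ := exists_gap hg hA hs hx
  cases k with
  | zero => simp [next₁_frontier_zero]; omega
  | succ k => rw [next₁_frontier_succ, Prod.mk.injEq]; dsimp only; omega

lemma next₂_eq_iff (hg : 1 ≤ g) (hA : A.HasConstantGapTolerance g) (hs : A.s = 0) {x : ℕ × ℕ}
    (hx : x ∈ states A frontier) (a b : ℕ) : next₂ A x = (a, b) ↔
      (x.2 = x.1 + g ∧ a = 0 ∧ b = 0) ∨ (x.2 < x.1 + g ∧ a = x.1 ∧ b = x.2 + 1) := by
  obtain ⟨l, k, hk, rfl⟩ := exists_gap hg hA hs hx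
  rcases hk.lt_or_eq with h | rfl
  · rw [next₂_of_lt hA l h, Prod.mk.injEq]; dsimp only; omega
  · rw [next₂_gap hA hs l, Prod.mk.injEq]; dsimp only; omega

lemma hasSum_inflow_succ_zero (hg : 1 ≤ g) (hA : A.HasConstantGapTolerance g) (hs : A.s = 0)
    (π : states A frontier → ℝ) (l : ℕ) :
    HasSum (fun m => π m * transition A frontier p₁ p₂ m
      ⟨(l + 1, l + 1 + 0), mem_states hg hA hs _ (Nat.zero_le _)⟩)
      (p₁ * zeroExtend π (l, l + 1)) := by
  rw [← add_zero (p₁ * _)]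
  refine hasSum_transition (hasSum_fiber π p₁ (fun h => ?_) fun x hx hxy => ?_)
    (hasSum_fiber_empty π p₂ fun x hx hxy => ?_)
  · rw [next₁_eq_iff hg hA hs h]; dsimp only; omega
  · rw [next₁_eq_iff hg hA hs hx] at hxy
    ext <;> dsimp only <;> omega
  · rw [next₂_eq_iff hg hA hs hx] at hxy
    obtain ⟨l', k, hk, rfl⟩ := exists_gap hg hA hs hx
    dsimp only at hxy; omega

lemma hasSum_inflow_zero_succ (hg : 1 ≤ g) (hA : A.HasConstantGapTolerance g) (hs : A.s = 0)
    (π : states A frontier → ℝ) {k : ℕ} (hk : k + 1 ≤ g) :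
    HasSum (fun m => π m * transition A frontier p₁ p₂ m
      ⟨(0, 0 + (k + 1)), mem_states hg hA hs _ hk⟩) (p₂ * zeroExtend π (0, 0 + k)) := by
  rw [← zero_add (p₂ * _)]
  refine hasSum_transition (hasSum_fiber_empty π p₁ fun x hx hxy => ?_)
    (hasSum_fiber π p₂ (fun h => ?_) fun x hx hxy => ?_)
  · rw [next₁_eq_iff hg hA hs hx] at hxy; omega
  · rw [next₂_eq_iff hg hA hs h]; dsimp only; omega
  · rw [next₂_eq_iff hg hA hs hx] at hxy
    ext <;> dsimp only <;> omega

/-- When `k + 1 = g`, the predecessor of gap `k + 2` is not a state, and `zeroExtend` makes its term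
vanish. -/
lemma hasSum_inflow_succ_succ (hg : 1 ≤ g) (hA : A.HasConstantGapTolerance g) (hs : A.s = 0)
    (π : states A frontier → ℝ) (l : ℕ) {k : ℕ} (hk : k + 1 ≤ g) :
    HasSum (fun m => π m * transition A frontier p₁ p₂ m
      ⟨(l + 1, l + 1 + (k + 1)), mem_states hg hA hs _ hk⟩)
      (p₁ * zeroExtend π (l, l + (k + 2)) + p₂ * zeroExtend π (l + 1, l + 1 + k)) := by
  refine hasSum_transition (hasSum_fiber π p₁ (fun h => ?_) fun x hx hxy => ?_)
    (hasSum_fiber π p₂ (fun h => ?_) fun x hx hxy => ?_)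
  · rw [next₁_eq_iff hg hA hs h]; dsimp only; omega
  · rw [next₁_eq_iff hg hA hs hx] at hxy
    ext <;> dsimp only <;> omega
  · rw [next₂_eq_iff hg hA hs h]; dsimp only; omega
  · rw [next₂_eq_iff hg hA hs hx] at hxy
    ext <;> dsimp only <;> omega

/-- The origin alone has infinitely many predecessors: all of gap `0` and all of gap `g`, each
entering by a capitulation. -/
lemma hasSum_inflow_zero_zero (hg : 1 ≤ g) (hA : A.HasConstantGapTolerance g) (hs : A.s = 0)
    (π : states A frontier → ℝ) {a b : ℝ}
    (ha : HasSum (fun l => zeroExtend π (l, l + 0)) a)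
    (hb : HasSum (fun l => zeroExtend π (l, l + g)) b) :
    HasSum (fun m => π m * transition A frontier p₁ p₂ m
      ⟨(0, 0 + 0), mem_states hg hA hs _ (Nat.zero_le _)⟩) (p₁ * a + p₂ * b) := by
  refine hasSum_transition (hasSum_column hg hA hs (Nat.zero_le g) _ (fun m hm => ?_) ?_)
    (hasSum_column hg hA hs le_rfl _ (fun m hm => ?_) ?_)
  · rw [if_neg, mul_zero]
    rw [next₁_eq_iff hg hA hs m.2]; omega
  · refine hasSum_of_eq (ha.mul_left p₁) (fun l => ?_) rfl
    change _ * (if next₁ frontier (l, l) = (0, 0) then p₁ else 0) = _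
    rw [if_pos (next₁_frontier_zero l), zeroExtend_of_mem π (mem_states hg hA hs l (Nat.zero_le _)),
      mul_comm]
  · rw [if_neg, mul_zero]
    rw [next₂_eq_iff hg hA hs m.2]; omega
  · refine hasSum_of_eq (hb.mul_left p₂) (fun l => ?_) rfl
    change _ * (if next₂ A (l, l + g) = (0, 0) then p₂ else 0) = _
    rw [if_pos (next₂_gap hA hs l), zeroExtend_of_mem π (mem_states hg hA hs l le_rfl),
      mul_comm]

/-- Every inflow away from the origin comes from a smaller `2 * l + k`, so strong induction applies;
the balance at `(0, 0)` plays no role. -/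
lemma IsStationary.zeroExtend_eq (hg : 1 ≤ g) (hA : A.HasConstantGapTolerance g) (hs : A.s = 0)
    {π : states A frontier → ℝ} (hπ : IsStationary A frontier p₁ p₂ π) (l k : ℕ) :
    zeroExtend π (l, l + k) = zeroExtend π (0, 0) * weight g p₁ p₂ l k := by
  induction hn : 2 * l + k using Nat.strong_induction_on generalizing l k with
  | _ n ih =>
    rcases Nat.lt_or_ge g k with hk | hk
    · rw [zeroExtend_of_notMem π (notMem_states hg hA hs l hk), weight_of_gap_lt _ hk, mul_zero]
    rw [zeroExtend_of_mem π (mem_states hg hA hs l hk)]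
    rcases l with - | l <;> rcases k with - | k
    · rw [weight_zero_zero, mul_one]
      exact (zeroExtend_of_mem π (mem_states hg hA hs 0 hk)).symm
    · rw [(hπ.balance _).unique (hasSum_inflow_zero_succ hg hA hs π hk), weight_zero_succ hk,
        ih _ (by omega) 0 k rfl]
      ring
    · rw [(hπ.balance _).unique (hasSum_inflow_succ_zero hg hA hs π l), weight_succ_zero,
        ih _ (by omega) l 1 rfl]
      ring
    · rw [(hπ.balance _).unique (hasSum_inflow_succ_succ hg hA hs π l hk), weight_succ_succ _ hk,
        ih (2 * l + (k + 2)) (by omega) l (k + 2) rfl,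
        ih (2 * (l + 1) + k) (by omega) (l + 1) k rfl]
      ring

/-- Total mass one fixes the remaining constant `π(0,0)`, which gives uniqueness. -/
lemma IsStationary.apply_eq (hg : 1 ≤ g) (hA : A.HasConstantGapTolerance g) (hs : A.s = 0)
    (hp₁ : 0 < p₁) (hp₂ : 0 < p₂) (hp : p₁ + p₂ = 1)
    {π : states A frontier → ℝ} (hπ : IsStationary A frontier p₁ p₂ π) (l : ℕ) {k : ℕ}
    (hk : k ≤ g) : π ⟨(l, l + k), mem_states hg hA hs l hk⟩
      = ((g : ℝ) + 2) / (2 * Gam g p₁ p₂) * weight g p₁ p₂ l k := by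
  have key : ∀ l k, ∀ hk : k ≤ g, π ⟨(l, l + k), mem_states hg hA hs l hk⟩
      = zeroExtend π (0, 0) * weight g p₁ p₂ l k := fun l k hk => by
    rw [← zeroExtend_of_mem π, hπ.zeroExtend_eq hg hA hs]
  have hsum := hasSum_states hg hA hs π fun k hk => by
    simp_rw [key _ k hk]
    exact (hasSum_weight hg hp₁ hp₂ hp k).mul_left (zeroExtend π (0, 0))
  have h1 := hsum.unique hπ.total
  have hG := Gam_pos hg hp₁ hp₂ hp
  rw [← Finset.mul_sum, sum_columnWeight hg hp₁ hp₂ hp] at h1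
  have : zeroExtend π (0, 0) = ((g : ℝ) + 2) / (2 * Gam g p₁ p₂) := by
    field_simp at h1 ⊢
    linarith
  rw [key l k hk, this]

/-- The stationary distribution. -/
noncomputable def stationaryDist (A : CapPolicy) (g : ℕ) (p₁ p₂ : ℝ) (m : states A frontier) : ℝ :=
  ((g : ℝ) + 2) / (2 * Gam g p₁ p₂) * weight g p₁ p₂ m.1.1 (m.1.2 - m.1.1)

lemma zeroExtend_stationaryDist (hg : 1 ≤ g) (hA : A.HasConstantGapTolerance g) (hs : A.s = 0)
    (l k : ℕ) : zeroExtend (stationaryDist A g p₁ p₂) (l, l + k)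
      = ((g : ℝ) + 2) / (2 * Gam g p₁ p₂) * weight g p₁ p₂ l k := by
  rcases Nat.lt_or_ge g k with hk | hk
  · rw [zeroExtend_of_notMem _ (notMem_states hg hA hs l hk), weight_of_gap_lt _ hk, mul_zero]
  · rw [zeroExtend_of_mem _ (mem_states hg hA hs l hk), stationaryDist]
    simp

lemma isStationary_stationaryDist (hg : 1 ≤ g) (hA : A.HasConstantGapTolerance g) (hs : A.s = 0)
    (hp₁ : 0 < p₁) (hp₂ : 0 < p₂) (hp : p₁ + p₂ = 1) :
    IsStationary A frontier p₁ p₂ (stationaryDist A g p₁ p₂) := by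
  have hG := Gam_pos hg hp₁ hp₂ hp
  have hz := zeroExtend_stationaryDist (p₁ := p₁) (p₂ := p₂) hg hA hs
  set c := ((g : ℝ) + 2) / (2 * Gam g p₁ p₂) with hc
  have happ : ∀ l k, ∀ hk : k ≤ g, stationaryDist A g p₁ p₂ ⟨(l, l + k), mem_states hg hA hs l hk⟩
      = c * weight g p₁ p₂ l k := fun l k hk => by
    rw [← zeroExtend_of_mem (stationaryDist A g p₁ p₂), hz]
  refine ⟨fun m => mul_nonneg (by positivity) (weight_nonneg hp₁ hp₂ _ _), ?_, ?_⟩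
  · have hsum := hasSum_states hg hA hs (stationaryDist A g p₁ p₂) fun k hk => by
      simp_rw [happ _ k hk]
      exact (hasSum_weight hg hp₁ hp₂ hp k).mul_left c
    rw [← Finset.mul_sum, sum_columnWeight hg hp₁ hp₂ hp] at hsum
    convert hsum using 1
    rw [hc]; field_simp
  · rintro ⟨x, hx⟩
    obtain ⟨l, k, hk, rfl⟩ := exists_gap hg hA hs hx
    rw [happ l k hk]
    rcases l with - | l <;> rcases k with - | k
    · have hcol : ∀ k, HasSum (fun l => zeroExtend (stationaryDist A g p₁ p₂) (l, l + k))
          (c * columnWeight g p₁ p₂ k) := fun k => by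
        simp_rw [hz]
        exact (hasSum_weight hg hp₁ hp₂ hp k).mul_left c
      have h := hasSum_inflow_zero_zero (p₁ := p₁) (p₂ := p₂) hg hA hs _ (hcol 0) (hcol g)
      -- The only balance equation not built into the recursion of `weight`.
      rw [weight_zero_zero, ← columnWeight_return hg hp₁ hp₂ hp]
      convert h using 1
      ring
    · have h := hasSum_inflow_zero_succ (p₁ := p₁) (p₂ := p₂) hg hA hs
        (stationaryDist A g p₁ p₂) hk
      rw [hz] at h
      rw [weight_zero_succ hk, mul_left_comm]
      exact h
    · have h := hasSum_inflow_succ_zero (p₁ := p₁) (p₂ := p₂) hg hA hs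
        (stationaryDist A g p₁ p₂) l
      rw [hz] at h
      rw [weight_succ_zero, mul_left_comm]
      exact h
    · have h := hasSum_inflow_succ_succ (p₁ := p₁) (p₂ := p₂) hg hA hs
        (stationaryDist A g p₁ p₂) l hk
      rw [hz, hz] at h
      rw [weight_succ_succ _ hk, mul_add, mul_left_comm c, mul_left_comm c]
      exact h

/-! ### The expected rewards. -/

lemma IsStationary.hasSum_rHat₁ (hg : 1 ≤ g) (hA : A.HasConstantGapTolerance g) (hs : A.s = 0)
    (hp₁ : 0 < p₁) (hp₂ : 0 < p₂) (hp : p₁ + p₂ = 1)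
    {π : states A frontier → ℝ} (hπ : IsStationary A frontier p₁ p₂ π) :
    HasSum (fun x => π x * rHat₁ A frontier p₁ x)
        (p₁ / Gam g p₁ p₂ *
          ∑ k ∈ Icc 1 (g + 1), Real.sin (Real.pi * k / (g + 2)) ^ 2 /
            (1 - 4 * p₁ * p₂ * Real.cos (Real.pi * k / (g + 2)) ^ 2) ^ 2) := by
  have hG := Gam_pos hg hp₁ hp₂ hp
  refine hasSum_column hg hA hs (Nat.zero_le g) _ (fun m hm => ?_) ?_
  · obtain ⟨l, k, hk, he⟩ := exists_gap hg hA hs m.2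
    simp only [he] at hm
    have : ¬ l + k ≤ l := by omega
    simp [rHat₁, frontier, he, show k ≠ 0 by omega]
  · simp_rw [hπ.apply_eq hg hA hs hp₁ hp₂ hp _ (Nat.zero_le g)]
    have h := (hasSum_weight_mul_spectral hg hp₁ hp₂ hp (Nat.zero_le g)).mul_left
      (((g : ℝ) + 2) / (2 * Gam g p₁ p₂) * p₁)
    refine hasSum_of_eq h (fun l => ?_) ?_
    · simp [rHat₁, frontier]
      ring
    · rw [Finset.mul_sum, Finset.mul_sum]
      refine Finset.sum_congr rfl fun j _ => ?_
      rw [show 4 * p₁ * p₂ * Real.cos (Real.pi * j / (g + 2)) ^ 2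
        = 4 * Real.cos (Real.pi * j / (g + 2)) ^ 2 * p₁ * p₂ by ring]
      simp only [Nat.cast_zero, zero_add, mul_one, pow_zero, zero_mul]
      field_simp

/-- Reflecting the strip sends gap `g` to gap `0` and multiplies mode `j` by `(-1) ^ (j - 1)`, the
source of the signs and of the squared sine in `ρ₂`. -/
lemma sin_reflect (g : ℕ) {j : ℕ} (hj : 1 ≤ j) :
    Real.sin (Real.pi * j * (g + 1) / (g + 2))
      = (-1) ^ (j - 1) * Real.sin (Real.pi * j / (g + 2)) := by
  have h : Real.pi * j * (g + 1) / ((g : ℝ) + 2) = j * Real.pi - Real.pi * j / (g + 2) := by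
    field_simp; ring
  obtain ⟨i, rfl⟩ : ∃ i, j = i + 1 := ⟨j - 1, by omega⟩
  rw [h, Real.sin_sub, Real.sin_nat_mul_pi, Real.cos_nat_mul_pi, Nat.add_sub_cancel, pow_succ]
  ring

lemma IsStationary.hasSum_rHat₂ (hg : 1 ≤ g) (hA : A.HasConstantGapTolerance g) (hs : A.s = 0)
    (hp₁ : 0 < p₁) (hp₂ : 0 < p₂) (hp : p₁ + p₂ = 1)
    {π : states A frontier → ℝ} (hπ : IsStationary A frontier p₁ p₂ π) :
    HasSum (fun x => π x * rHat₂ A frontier p₂ x)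
        (p₂ ^ (g + 1) / Gam g p₁ p₂ *
          ∑ k ∈ Icc 1 (g + 1), (-1 : ℝ) ^ (k - 1) *
            (Real.sin (Real.pi * k / (g + 2)) ^ 2 *
                (2 * Real.cos (Real.pi * k / (g + 2))) ^ g /
              (1 - 4 * p₁ * p₂ * Real.cos (Real.pi * k / (g + 2)) ^ 2) ^ 2 *
              (g * (1 - 4 * p₁ * p₂ * Real.cos (Real.pi * k / (g + 2)) ^ 2) + 1))) := by
  have hG := Gam_pos hg hp₁ hp₂ hp
  refine hasSum_column hg hA hs le_rfl _ (fun m hm => ?_) ?_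
  · obtain ⟨l, k, hk, he⟩ := exists_gap hg hA hs m.2
    simp only [he] at hm
    rw [rHat₂, he, if_neg, mul_zero]
    rw [hA.eq_true_iff l hk]
    omega
  · simp_rw [hπ.apply_eq hg hA hs hp₁ hp₂ hp _ le_rfl]
    have h := (hasSum_weight_mul_spectral hg hp₁ hp₂ hp (le_refl g)).mul_left
      (((g : ℝ) + 2) / (2 * Gam g p₁ p₂) * p₂)
    refine hasSum_of_eq h (fun l => ?_) ?_
    · simp only [rHat₂, hA.eq_true l, if_true, hs]
      push_cast
      ring
    · rw [Finset.mul_sum, Finset.mul_sum]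
      refine Finset.sum_congr rfl fun j hj => ?_
      rw [show 4 * p₁ * p₂ * Real.cos (Real.pi * j / (g + 2)) ^ 2
        = 4 * Real.cos (Real.pi * j / (g + 2)) ^ 2 * p₁ * p₂ by ring,
        sin_reflect g (Finset.mem_Icc.mp hj).1, mul_pow _ p₂]
      have : ((g : ℝ) + 2) / (2 * Gam g p₁ p₂) * p₂ * (2 / ((g : ℝ) + 2)) = p₂ / Gam g p₁ p₂ := by
        field_simp
      rw [mul_assoc (2 / ((g : ℝ) + 2)), ← mul_assoc _ (2 / ((g : ℝ) + 2)), this]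
      ring

end States

end MiningGame

theorem mainTheorem4 (g : ℕ) (hg : 1 ≤ g) (p₁ p₂ : ℝ) (hp₁ : 0 < p₁) (hp₂ : 0 < p₂)
    (hp : p₁ + p₂ = 1) (A : MiningGame.CapPolicy) (hA : A.HasConstantGapTolerance g)
    (hs : A.s = 0) :
    MiningGame.states A MiningGame.frontier = {m | ∃ ℓ k : ℕ, k ≤ g ∧ m = (ℓ, ℓ + k)} ∧
    0 < MiningGame.Gam g p₁ p₂ ∧
    (∃! π : MiningGame.states A MiningGame.frontier → ℝ,
      MiningGame.IsStationary A MiningGame.frontier p₁ p₂ π) ∧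
    ∀ π : MiningGame.states A MiningGame.frontier → ℝ,
      MiningGame.IsStationary A MiningGame.frontier p₁ p₂ π →
      (∀ (ℓ m : ℕ) (h₀ : (0, 0) ∈ MiningGame.states A MiningGame.frontier)
        (h : (ℓ, ℓ + m) ∈ MiningGame.states A MiningGame.frontier),
        π ⟨(ℓ, ℓ + m), h⟩ = π ⟨(0, 0), h₀⟩ *
          (MiningGame.pathCount A MiningGame.frontier ℓ (ℓ + m) : ℝ) * p₁ ^ ℓ * p₂ ^ (ℓ + m)) ∧
      HasSum (fun x => π x * MiningGame.rHat₁ A MiningGame.frontier p₁ x)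
        (p₁ / MiningGame.Gam g p₁ p₂ *
          ∑ k ∈ Finset.Icc 1 (g + 1), Real.sin (Real.pi * k / (g + 2)) ^ 2 /
            (1 - 4 * p₁ * p₂ * Real.cos (Real.pi * k / (g + 2)) ^ 2) ^ 2) ∧
      HasSum (fun x => π x * MiningGame.rHat₂ A MiningGame.frontier p₂ x)
        (p₂ ^ (g + 1) / MiningGame.Gam g p₁ p₂ *
          ∑ k ∈ Finset.Icc 1 (g + 1), (-1 : ℝ) ^ (k - 1) *
            (Real.sin (Real.pi * k / (g + 2)) ^ 2 *
                (2 * Real.cos (Real.pi * k / (g + 2))) ^ g /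
              (1 - 4 * p₁ * p₂ * Real.cos (Real.pi * k / (g + 2)) ^ 2) ^ 2 *
              (g * (1 - 4 * p₁ * p₂ * Real.cos (Real.pi * k / (g + 2)) ^ 2) + 1))) := by
  open MiningGame in
  refine ⟨states_frontier hg hA hs, Gam_pos hg hp₁ hp₂ hp,
    ⟨stationaryDist A g p₁ p₂, isStationary_stationaryDist hg hA hs hp₁ hp₂ hp, ?_⟩, ?_⟩
  · intro π hπ
    funext ⟨x, hx⟩
    obtain ⟨l, k, hk, rfl⟩ := exists_gap hg hA hs hx
    rw [hπ.apply_eq hg hA hs hp₁ hp₂ hp l hk,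
      (isStationary_stationaryDist hg hA hs hp₁ hp₂ hp).apply_eq hg hA hs hp₁ hp₂ hp l hk]
  · intro π hπ
    refine ⟨fun l k h₀ h => ?_, hπ.hasSum_rHat₁ hg hA hs hp₁ hp₂ hp,
      hπ.hasSum_rHat₂ hg hA hs hp₁ hp₂ hp⟩
    have hk : k ≤ g := by
      by_contra hk
      exact notMem_states hg hA hs l (by omega) h
    rw [← zeroExtend_of_mem π h, ← zeroExtend_of_mem π h₀, hπ.zeroExtend_eq hg hA hs,
      pathCount_frontier hA l hk, weight]
    ring
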